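/- Let $\mathbb{F}$ be a field. An algebraic circuit over $\mathbb{F}$ in the variables $x_1,\dots,x_n$ is a finite layered directed acyclic graph (edges join consecutive layers) with alternating layers of $+$ and $\times$ gates of arbitrary fan-in, whose leaves are labeled by variables or by constants from $\mathbb{F}$, and with one output gate; it computes a polynomial in $\mathbb{F}[x_1,\dots,x_n]$ in the natural way, and its size is its number of vertices. For $f\in\mathbb{F}[x_1,\dots,x_n]$, let $\mathrm{size}(f)$ be the smallest size of an algebraic circuit over $\mathbb{F}$ that computes $f$. Theorem (Kaltofen). There is a polynomial $P$ in three variables with non-negative integer coefficients such that, for every field $\mathbb{F}$ of characteristic zero, all integers $n\ge 0$ and $e\ge 1$, and all polynomials $f,g\in\mathbb{F}[x_1,\dots,x_n]$ with $f=g^e$, $$\mathrm{size}(g)\le P\big(\mathrm{size}(f),\deg(g),n\big),$$ where $\deg$ is the total degree (with $\deg 0 = 0$). In particular, the bound does not depend on $e$. -/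

import Mathlib

/-- A label of an input (leaf) gate: one of the variables `x_0, …, x_{n-1}` or a constant. -/
abbrev LeafLabel (F : Type*) (n : ℕ) : Type _ := Fin n ⊕ F

/-- The polynomial computed by a leaf gate. -/
noncomputable def LeafLabel.poly {F : Type*} [CommSemiring F] {n : ℕ} :
    LeafLabel F n → MvPolynomial (Fin n) F
  | .inl i => MvPolynomial.X i
  | .inr a => MvPolynomial.C a

/-- An algebraic circuit over `F` in `n` variables: a layered directed acyclic graph whose edges
join consecutive layers, with alternating layers of `+` and `×` gates (of arbitrary fan-in) and
one output gate. The layers are numbered from the bottom, and the circuit consists of the layers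
`0, …, depth`; the output gate is in layer `depth`. A vertex is either a leaf, labeled by a
variable or by a constant, or a gate with a nonempty set of children in the layer below (so
every vertex of layer `0` is a leaf). Anything in layers above `depth` is not part of the circuit
and is not counted in its size. -/
structure AlgCircuit (F : Type*) (n : ℕ) where
  depth : ℕ
  Layer : ℕ → Type
  [fintypeLayer : ∀ i, Fintype (Layer i)]
  /-- whether the gates of layer `i` are `+` gates (`true`) or `×` gates (`false`) -/
  isSum : ℕ → Bool
  isSum_succ : ∀ i, isSum (i + 1) = !(isSum i)
  bottom : Layer 0 → LeafLabel F n
  node : ∀ i, Layer (i + 1) → LeafLabel F n ⊕ {S : Finset (Layer i) // S.Nonempty}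
  output : Layer depth

attribute [instance] AlgCircuit.fintypeLayer

namespace AlgCircuit

/-- The polynomial computed at a vertex of layer `i`. -/
noncomputable def value {F : Type*} [CommSemiring F] {n : ℕ} (C : AlgCircuit F n) :
    (i : ℕ) → C.Layer i → MvPolynomial (Fin n) F
  | 0, v => (C.bottom v).poly
  | i + 1, v =>
    match C.node i v with
    | .inl l => l.poly
    | .inr S =>
      if C.isSum (i + 1) = true then ∑ u ∈ S.1, C.value i u else ∏ u ∈ S.1, C.value i u

/-- The circuit computes `f` if `f` is the polynomial computed at its output gate. -/
def Computes {F : Type*} [CommSemiring F] {n : ℕ} (C : AlgCircuit F n)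
    (f : MvPolynomial (Fin n) F) : Prop :=
  C.value C.depth C.output = f

/-- The size of a circuit: its number of vertices. -/
def size {F : Type*} {n : ℕ} (C : AlgCircuit F n) : ℕ :=
  ∑ i ∈ Finset.range (C.depth + 1), Fintype.card (C.Layer i)

end AlgCircuit

/-- `circuitSize f` is the size of a smallest algebraic circuit over `F` that computes `f`. -/
noncomputable def circuitSize {F : Type*} [CommSemiring F] {n : ℕ}
    (f : MvPolynomial (Fin n) F) : ℕ :=
  sInf {s : ℕ | ∃ C : AlgCircuit F n, C.Computes f ∧ C.size = s}

/-- The layers of the circuit that sums up the monomials of `f`: leaves, products, sum. -/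
abbrev MonomialLayer {F : Type*} [CommSemiring F] {n : ℕ} (f : MvPolynomial (Fin n) F) : ℕ → Type
  | 0 => Σ m : f.support, Option (Σ j : Fin n, Fin (m.1 j))
  | 1 => Option f.support
  | _ + 2 => Unit

/-- The circuit that sums up the monomials of `f`. -/
noncomputable def monomialCircuit {F : Type*} [CommSemiring F] {n : ℕ}
    (f : MvPolynomial (Fin n) F) : AlgCircuit F n where
  depth := 2
  Layer := MonomialLayer f
  fintypeLayer
    | 0 => inferInstanceAs (Fintype (Σ m : f.support, Option (Σ j : Fin n, Fin (m.1 j))))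
    | 1 => inferInstanceAs (Fintype (Option f.support))
    | _ + 2 => inferInstanceAs (Fintype Unit)
  isSum i := decide (Even i)
  isSum_succ i := by by_cases h : Even i <;> simp [h, Nat.even_add_one]
  bottom
    | ⟨m, none⟩ => .inr (f.coeff m.1)
    | ⟨_, some j⟩ => .inl j.1
  node
    | 0, none => .inl (.inr 0)
    | 0, some m => .inr ⟨(Finset.univ : Finset (Option (Σ j : Fin n, Fin (m.1 j)))).map
        (Function.Embedding.sigmaMk (β := fun m : f.support =>
          Option (Σ j : Fin n, Fin (m.1 j))) m), by simp⟩
    | 1, _ => .inr ⟨(Finset.univ : Finset (Option f.support)), ⟨none, Finset.mem_univ _⟩⟩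
    | _ + 2, _ => .inl (.inr 0)
  output := ()

/-- Every polynomial is computed by some circuit. -/
theorem AlgCircuit.exists_computes {F : Type*} [CommSemiring F] {n : ℕ}
    (f : MvPolynomial (Fin n) F) : ∃ C : AlgCircuit F n, C.Computes f := by
  refine ⟨monomialCircuit f, ?_⟩
  obtain ⟨v0, hv0⟩ : ∃ v : (Σ m : f.support, Option (Σ j : Fin n, Fin (m.1 j))) →
      MvPolynomial (Fin n) F, v = (monomialCircuit f).value 0 := ⟨_, rfl⟩
  obtain ⟨v1, hv1⟩ : ∃ v : Option f.support → MvPolynomial (Fin n) F,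
      v = (monomialCircuit f).value 1 := ⟨_, rfl⟩
  have h0 : v1 none = 0 := by
    rw [hv1]
    change MvPolynomial.C (0 : F) = 0
    simp
  have h1 : ∀ m : f.support, v1 (some m) = MvPolynomial.monomial m.1 (f.coeff m.1) := by
    intro m
    have e : v1 (some m) =
        ∏ u ∈ (Finset.univ : Finset (Option (Σ j : Fin n, Fin (m.1 j)))).map
              (Function.Embedding.sigmaMk (β := fun m : f.support =>
                Option (Σ j : Fin n, Fin (m.1 j))) m), v0 u := by
      rw [hv0, hv1]; rfl
    have e0 : v0 ⟨m, none⟩ = MvPolynomial.C (f.coeff m.1) := by rw [hv0]; rfl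
    have e1 : ∀ j, v0 ⟨m, some j⟩ = MvPolynomial.X j.1 := fun _ => by rw [hv0]; rfl
    rw [e, Finset.prod_map, Fintype.prod_option]
    simp only [Function.Embedding.sigmaMk_apply, e0, e1]
    rw [Fintype.prod_sigma, MvPolynomial.monomial_eq, Finsupp.prod_fintype _ _ (by simp)]
    simp
  have h2 : (monomialCircuit f).value 2 () = ∑ u : Option f.support, v1 u := by rw [hv1]; rfl
  refine Eq.trans h2 ?_
  rw [Fintype.sum_option, h0, zero_add]
  simp only [h1]
  rw [Finset.sum_coe_sort f.support (fun m => MvPolynomial.monomial m (f.coeff m))]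
  exact f.support_sum_monomial_coeff

/-- The minimum in the definition of `circuitSize` is attained. -/
theorem exists_computes_size_eq_circuitSize {F : Type*} [CommSemiring F] {n : ℕ}
    (f : MvPolynomial (Fin n) F) :
    ∃ C : AlgCircuit F n, C.Computes f ∧ C.size = circuitSize f := by
  obtain ⟨C, hC⟩ := AlgCircuit.exists_computes f
  exact Nat.sInf_mem (s := {s : ℕ | ∃ C : AlgCircuit F n, C.Computes f ∧ C.size = s})
    ⟨C.size, C, hC, rfl⟩

/-! Pick a point a with g(a) ≠ 0 and restrict to the line a + t(x - a): G(t) has constant term the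
scalar g(a) and degree at most deg g in t, and G(1) = g. Comparing coefficients in G·(G^e)' =
e·G'·G^e (`Polynomial.coeff_pow_recurrence`) expresses each coefficient of G through earlier ones
and coefficients of G^e, dividing only by the scalar e·t·g(a)^e, with t now the index; it is nonzero
in characteristic zero. Hence only the coefficients of G^e below D = deg g + 1 matter. They come
from simulating a circuit for f gate by gate modulo t^D (`AlgCircuit.adds_output`), at a cost in
which neither e nor deg f appears. `adds_root` then yields the coefficients of G, whose sum is g.
Costs are counted in straight-line programs, which compose easily;
`circuitSize_le_of_straightLineComputes` returns to alternating layers with quadratic loss. -/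

open MvPolynomial

/-! ### Straight-line programs and truncated power series arithmetic. -/

section StraightLine

variable {F : Type*} {n : ℕ}

/-- Every `v i` with `i < m` is a leaf, or the sum or product of two earlier values. -/
def IsStraightLine [CommSemiring F] (v : ℕ → MvPolynomial (Fin n) F) (m : ℕ) : Prop :=
  ∀ i < m, (∃ l : LeafLabel F n, v i = l.poly) ∨
    ∃ j < i, ∃ k < i, v i = v j + v k ∨ v i = v j * v k

/-- All elements of `S` occur in one straight-line program of length at most `m`. -/
def StraightLineComputes [CommSemiring F] (S : Set (MvPolynomial (Fin n) F)) (m : ℕ) : Prop :=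
  ∃ m' ≤ m, ∃ v, IsStraightLine v m' ∧ ∀ p ∈ S, ∃ i < m', v i = p

/-- Given the elements of `S`, those of `A` are computed with at most `c` further operations. -/
def Adds [CommSemiring F] (S A : Set (MvPolynomial (Fin n) F)) (c : ℕ) : Prop :=
  ∀ S', S ⊆ S' → ∀ m, StraightLineComputes S' m → StraightLineComputes (S' ∪ A) (m + c)

theorem StraightLineComputes.mono [CommSemiring F] {S T : Set (MvPolynomial (Fin n) F)} {m k : ℕ}
    (h : StraightLineComputes S m) (hT : T ⊆ S) (hk : m ≤ k) : StraightLineComputes T k := by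
  obtain ⟨m', hm, v, hv, hS⟩ := h
  exact ⟨m', hm.trans hk, v, hv, fun p hp => hS p (hT hp)⟩

theorem straightLineComputes_empty [CommSemiring F] :
    StraightLineComputes (∅ : Set (MvPolynomial (Fin n) F)) 0 :=
  ⟨0, le_rfl, fun _ => 0, fun i hi => absurd hi (Nat.not_lt_zero i), fun _ hp => hp.elim⟩

theorem IsStraightLine.snoc [CommSemiring F] {v : ℕ → MvPolynomial (Fin n) F} {m : ℕ}
    (hv : IsStraightLine v m) (p : MvPolynomial (Fin n) F)
    (hp : (∃ l : LeafLabel F n, p = l.poly) ∨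
      ∃ j < m, ∃ k < m, p = v j + v k ∨ p = v j * v k) :
    IsStraightLine (Function.update v m p) (m + 1) := by
  have old : ∀ i < m, Function.update v m p i = v i := fun i hi =>
    Function.update_of_ne hi.ne _ _
  intro i hi
  rcases Nat.lt_succ_iff_lt_or_eq.1 hi with hi | rfl
  · rw [old i hi]
    refine (hv i hi).imp_right ?_
    rintro ⟨j, hj, k, hk, h⟩
    exact ⟨j, hj, k, hk, by rwa [old j (hj.trans hi), old k (hk.trans hi)]⟩
  · rw [Function.update_self]
    refine hp.imp_right ?_
    rintro ⟨j, hj, k, hk, h⟩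
    exact ⟨j, hj, k, hk, by rwa [old j hj, old k hk]⟩

theorem StraightLineComputes.insert [CommSemiring F] {S : Set (MvPolynomial (Fin n) F)} {m : ℕ}
    (h : StraightLineComputes S m) (p : MvPolynomial (Fin n) F)
    (hp : (∃ l : LeafLabel F n, p = l.poly) ∨
      ∃ q ∈ S, ∃ r ∈ S, p = q + r ∨ p = q * r) :
    StraightLineComputes (S ∪ {p}) (m + 1) := by
  obtain ⟨m', hm, v, hv, hS⟩ := h
  refine ⟨m' + 1, by omega, _, hv.snoc p (hp.imp_right ?_), ?_⟩
  · rintro ⟨q, hq, r, hr, h⟩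
    obtain ⟨j, hj, rfl⟩ := hS q hq
    obtain ⟨k, hk, rfl⟩ := hS r hr
    exact ⟨j, hj, k, hk, h⟩
  · rintro q (hq | rfl)
    · obtain ⟨i, hi, rfl⟩ := hS q hq
      exact ⟨i, by omega, Function.update_of_ne hi.ne _ _⟩
    · exact ⟨m', by omega, Function.update_self _ _ _⟩

namespace Adds

variable [CommSemiring F] {S T A B : Set (MvPolynomial (Fin n) F)}
  {p q : MvPolynomial (Fin n) F} {a b c : ℕ}

theorem mono (h : Adds S A a) (hS : S ⊆ T) (hA : B ⊆ A) (hc : a ≤ c) : Adds T B c :=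
  fun S' hS' m hm => (h S' (hS.trans hS') m hm).mono (Set.union_subset_union_right _ hA) (by omega)

theorem of_subset (h : A ⊆ S) : Adds S A 0 := fun _ hS' _ hm =>
  hm.mono (Set.union_subset le_rfl (h.trans hS')) le_rfl

theorem of_mem (h : p ∈ S) : Adds S {p} 0 := of_subset (Set.singleton_subset_iff.2 h)

/-- Costs add up because `Adds` quantifies over every larger set of available results: nothing
computed before is lost, and shared intermediate results are paid for once. -/
theorem trans (h : Adds S A a) (h' : Adds (S ∪ A) B b) : Adds S B (a + b) := fun S' hS' m hm =>
  (h' (S' ∪ A) (Set.union_subset_union_left _ hS') _ (h S' hS' m hm)).mono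
    (Set.union_subset_union_left _ Set.subset_union_left) (by omega)

theorem self_union (h : Adds S A a) : Adds S (S ∪ A) a := fun _ hS' m hm =>
  (h _ hS' m hm).mono (Set.union_subset Set.subset_union_left
    (Set.union_subset_union_left _ hS')) le_rfl

theorem union (h : Adds S A a) (h' : Adds S B b) : Adds S (A ∪ B) (a + b) := fun S' hS' m hm =>
  (h' (S' ∪ A) (hS'.trans Set.subset_union_left) _ (h S' hS' m hm)).mono
    (Set.union_assoc _ _ _).ge (by omega)

theorem leaf (l : LeafLabel F n) : Adds S {l.poly} 1 := fun _ _ _ hm =>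
  hm.insert _ (.inl ⟨l, rfl⟩)

theorem C (x : F) : Adds S {(MvPolynomial.C x : MvPolynomial (Fin n) F)} 1 := leaf (.inr x)

theorem X (i : Fin n) : Adds S {(MvPolynomial.X i : MvPolynomial (Fin n) F)} 1 := leaf (.inl i)

theorem zero : Adds S {(0 : MvPolynomial (Fin n) F)} 1 := by
  simpa using C (S := S) (n := n) (0 : F)

theorem add (hp : Adds S {p} a) (hq : Adds S {q} b) : Adds S {p + q} (a + b + 1) :=
  (hp.union hq).trans fun _ hS' _ hm => hm.insert _
    (.inr ⟨p, hS' (by simp), q, hS' (by simp), .inl rfl⟩)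

theorem mul (hp : Adds S {p} a) (hq : Adds S {q} b) : Adds S {p * q} (a + b + 1) :=
  (hp.union hq).trans fun _ hS' _ hm => hm.insert _
    (.inr ⟨p, hS' (by simp), q, hS' (by simp), .inr rfl⟩)

theorem sum {ι : Type*} (s : Finset ι) (x : ι → MvPolynomial (Fin n) F)
    (h : ∀ i ∈ s, Adds S {x i} c) : Adds S {∑ i ∈ s, x i} (s.card * (c + 1) + 1) := by
  classical
  induction s using Finset.induction_on with
  | empty => simpa using zero
  | insert i s hi ih =>
    rw [Finset.sum_insert hi, Finset.card_insert_of_notMem hi]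
    refine ((h i (Finset.mem_insert_self i s)).add
      (ih fun j hj => h j (Finset.mem_insert_of_mem hj))).mono le_rfl le_rfl ?_
    linarith

theorem biUnion {ι : Type*} (s : Finset ι) (A : ι → Set (MvPolynomial (Fin n) F))
    (h : ∀ i ∈ s, Adds S (A i) c) : Adds S (⋃ i ∈ s, A i) (s.card * c) := by
  classical
  induction s using Finset.induction_on with
  | empty => simpa using of_subset (Set.empty_subset S)
  | insert i s hi ih =>
    rw [Finset.set_biUnion_insert, Finset.card_insert_of_notMem hi]
    refine ((h i (Finset.mem_insert_self i s)).union
      (ih fun j hj => h j (Finset.mem_insert_of_mem hj))).mono le_rfl le_rfl ?_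
    linarith

end Adds

/-- The coefficients of `Q` in degrees below `D`. -/
def truncCoeffs [CommSemiring F] (D : ℕ) (Q : Polynomial (MvPolynomial (Fin n) F)) :
    Set (MvPolynomial (Fin n) F) :=
  ⋃ k ∈ Finset.range D, {Q.coeff k}

theorem coeff_mem_truncCoeffs [CommSemiring F] {D k : ℕ} (Q : Polynomial (MvPolynomial (Fin n) F))
    (hk : k < D) : Q.coeff k ∈ truncCoeffs D Q := by
  simp only [truncCoeffs, Set.mem_iUnion, Finset.mem_range]
  exact ⟨k, hk, rfl⟩

namespace Adds

variable [CommSemiring F] {S : Set (MvPolynomial (Fin n) F)} {D c : ℕ}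
  {P Q : Polynomial (MvPolynomial (Fin n) F)}

theorem truncCoeffs_of_forall (h : ∀ k < D, Adds S {Q.coeff k} c) : Adds S (truncCoeffs D Q) (D * c) := by
  simpa [truncCoeffs] using biUnion (Finset.range D) (fun k => {Q.coeff k}) fun k hk =>
    h k (Finset.mem_range.1 hk)

/-- Coefficients of a product below degree D involve only coefficients of the factors below D. Each
is a sum of at most D products, hence costs at most 2D + 1. -/
theorem truncCoeffs_mul {a b : ℕ} (hP : Adds S (truncCoeffs D P) a)
    (hQ : Adds S (truncCoeffs D Q) b) :
    Adds S (truncCoeffs D (P * Q)) (a + b + D * (2 * D + 1)) := by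
  refine (hP.union hQ).trans (truncCoeffs_of_forall fun k hk => ?_)
  rw [Polynomial.coeff_mul]
  refine (sum (c := 1) _ _ fun i hi => ?_).mono le_rfl le_rfl
    (c := 2 * D + 1) (by rw [Finset.Nat.card_antidiagonal]; omega)
  have := Finset.HasAntidiagonal.mem_antidiagonal.1 hi
  exact (of_mem (.inr (.inl (coeff_mem_truncCoeffs P (by omega))))).mul
    (of_mem (.inr (.inr (coeff_mem_truncCoeffs Q (by omega)))))

theorem truncCoeffs_C_C (x : F) :
    Adds S (truncCoeffs D (Polynomial.C (MvPolynomial.C x : MvPolynomial (Fin n) F)))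
      (D * 1) := by
  refine truncCoeffs_of_forall fun k _ => ?_
  rw [Polynomial.coeff_C]
  split_ifs
  exacts [C x, zero]

theorem truncCoeffs_prod {ι : Type*} (s : Finset ι) (x : ι → Polynomial (MvPolynomial (Fin n) F))
    (h : ∀ i ∈ s, truncCoeffs D (x i) ⊆ S) :
    Adds S (truncCoeffs D (∏ i ∈ s, x i)) ((s.card + 1) * (D * (2 * D + 1))) := by
  classical
  induction s using Finset.induction_on with
  | empty =>
    refine (truncCoeffs_C_C (S := S) (n := n) (D := D) (1 : F)).mono le_rfl (by simp) ?_
    simp only [Finset.card_empty, zero_add, one_mul]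
    exact Nat.mul_le_mul_left _ (by omega)
  | insert i s hi ih =>
    rw [Finset.prod_insert hi, Finset.card_insert_of_notMem hi]
    refine ((of_subset (h i (Finset.mem_insert_self i s))).truncCoeffs_mul
      (ih fun j hj => h j (Finset.mem_insert_of_mem hj))).mono le_rfl le_rfl ?_
    linarith

theorem truncCoeffs_sum {ι : Type*} (s : Finset ι) (x : ι → Polynomial (MvPolynomial (Fin n) F))
    (h : ∀ i ∈ s, truncCoeffs D (x i) ⊆ S) :
    Adds S (truncCoeffs D (∑ i ∈ s, x i)) ((s.card + 1) * (D * (2 * D + 1))) := by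
  refine (truncCoeffs_of_forall (c := s.card + 1) fun k hk => ?_).mono le_rfl le_rfl ?_
  · rw [Polynomial.finsetSum_coeff]
    simpa using sum (c := 0) s (fun i => (x i).coeff k) fun i hi =>
      of_mem (h i hi (coeff_mem_truncCoeffs _ hk))
  · nlinarith [Nat.zero_le ((s.card + 1) * D * D)]

/-- A sequence can be computed term by term. -/
theorem truncCoeffs_of_prefix
    (h : ∀ k < D, Adds (S ∪ truncCoeffs k Q) {Q.coeff k} c) :
    Adds S (truncCoeffs D Q) (D * c) := by
  induction D with
  | zero => simpa [truncCoeffs] using of_subset (Set.empty_subset S)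
  | succ D ih =>
    refine ((ih fun k hk => h k (hk.trans D.lt_succ_self)).trans
      (h D D.lt_succ_self).self_union).mono le_rfl ?_ (by linarith)
    intro p hp
    simp only [truncCoeffs, Finset.range_add_one, Finset.set_biUnion_insert] at hp ⊢
    rcases hp with hp | hp
    exacts [.inr hp, .inl (.inr hp)]

end Adds

end StraightLine

/-! ### Restriction to a line through a base point. -/

section Shift

variable {F : Type*} [CommRing F] {n : ℕ}

/-- The restriction `p (a + t (x - a))` of `p` to the line through `a` and `x`, as a polynomial
in `t`. -/
noncomputable def lineRestrict (a : Fin n → F) :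
    MvPolynomial (Fin n) F →ₐ[F] Polynomial (MvPolynomial (Fin n) F) :=
  aeval fun i => Polynomial.C (C (a i)) + Polynomial.X * Polynomial.C (X i - C (a i))

theorem lineRestrict_C (a : Fin n → F) (x : F) :
    lineRestrict a (C x) = Polynomial.C (C x) := by
  rw [lineRestrict, MvPolynomial.aeval_C]; rfl

theorem lineRestrict_X (a : Fin n → F) (i : Fin n) : lineRestrict a (X i) =
    Polynomial.C (C (a i)) + Polynomial.X * Polynomial.C (X i - C (a i)) := by
  rw [lineRestrict, MvPolynomial.aeval_X]

theorem coeff_zero_lineRestrict (a : Fin n → F) (p : MvPolynomial (Fin n) F) :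
    (lineRestrict a p).coeff 0 = C (eval a p) := by
  rw [Polynomial.coeff_zero_eq_eval_zero]
  induction p using MvPolynomial.induction_on with
  | C x => simp
  | add p q hp hq => simp [hp, hq]
  | mul_X p i hp => simp [hp, lineRestrict_X]

theorem eval_one_lineRestrict (a : Fin n → F) (p : MvPolynomial (Fin n) F) :
    (lineRestrict a p).eval 1 = p := by
  induction p using MvPolynomial.induction_on with
  | C x => simp
  | add p q hp hq => simp [hp, hq]
  | mul_X p i hp => simp [hp, lineRestrict_X]

theorem natDegree_lineRestrict_le (a : Fin n → F) (p : MvPolynomial (Fin n) F) :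
    (lineRestrict a p).natDegree ≤ p.totalDegree := by
  conv_lhs => rw [p.as_sum, map_sum]
  refine Polynomial.natDegree_sum_le_of_forall_le _ _ fun m hm => ?_
  rw [lineRestrict, MvPolynomial.aeval_monomial]
  refine Polynomial.natDegree_mul_le.trans ?_
  have h0 : (algebraMap F (Polynomial (MvPolynomial (Fin n) F)) (coeff m p)).natDegree = 0 :=
    Polynomial.natDegree_C _
  rw [h0, zero_add]
  refine le_trans ?_ (le_totalDegree hm)
  refine (Polynomial.natDegree_prod_le _ _).trans (Finset.sum_le_sum fun i _ => ?_)
  refine Polynomial.natDegree_pow_le.trans ?_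
  refine (Nat.mul_le_mul_left _ (?_ : _ ≤ 1)).trans (mul_one _).le
  compute_degree

theorem Adds.truncCoeffs_lineRestrict_leaf (a : Fin n → F) (l : LeafLabel F n)
    {S : Set (MvPolynomial (Fin n) F)} {D : ℕ} (hD : 1 ≤ D) :
    Adds S (truncCoeffs D (lineRestrict a l.poly)) (D * (2 * D + 1)) := by
  suffices h : Adds S (truncCoeffs D (lineRestrict a l.poly)) (D * 3) from
    h.mono le_rfl le_rfl (Nat.mul_le_mul_left _ (by omega))
  rcases l with i | x
  · refine Adds.truncCoeffs_of_forall fun k _ => ?_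
    simp only [LeafLabel.poly, lineRestrict_X, Polynomial.coeff_add, Polynomial.coeff_C]
    rcases k with _ | _ | k
    · simpa using (Adds.C (a i)).mono le_rfl le_rfl (by omega)
    · simpa [sub_eq_add_neg] using (Adds.X (S := S) i).add (Adds.C (-a i))
    · simpa using Adds.zero.mono le_rfl le_rfl (by omega)
  · simp only [LeafLabel.poly, lineRestrict_C]
    exact (Adds.truncCoeffs_C_C x).mono le_rfl le_rfl (by omega)

end Shift

/-! ### Simulating a circuit modulo t^D. -/

section Circuit

variable {F : Type*} [CommRing F] {n : ℕ}

theorem AlgCircuit.card_layer_le_size {F : Type*} {n : ℕ} (A : AlgCircuit F n) {i : ℕ} (hi : i ≤ A.depth) :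
    Fintype.card (A.Layer i) ≤ A.size :=
  Finset.single_le_sum (f := fun i => Fintype.card (A.Layer i)) (fun _ _ => Nat.zero_le _)
    (Finset.mem_range.2 (Nat.lt_succ_of_le hi))

/-- Restriction to a line is a ring homomorphism, so it commutes with every gate. The children of a
gate form a set inside one layer, so fan-in is at most the size. -/
theorem AlgCircuit.adds_layer (A : AlgCircuit F n) (a : Fin n → F) {D : ℕ} (hD : 1 ≤ D) (i : ℕ)
    (hi : i ≤ A.depth) :
    Adds ∅ (⋃ v ∈ (Finset.univ : Finset (A.Layer i)), truncCoeffs D (lineRestrict a (A.value i v)))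
      ((∑ j ∈ Finset.range (i + 1), Fintype.card (A.Layer j)) *
        ((A.size + 1) * (D * (2 * D + 1)))) := by
  have le : D * (2 * D + 1) ≤ (A.size + 1) * (D * (2 * D + 1)) :=
    Nat.le_mul_of_pos_left _ (Nat.succ_pos _)
  induction i with
  | zero =>
    refine (Adds.biUnion (c := (A.size + 1) * (D * (2 * D + 1))) _ _ fun v _ => ?_).mono
      le_rfl le_rfl (by simp)
    rw [AlgCircuit.value]
    exact (Adds.truncCoeffs_lineRestrict_leaf a _ hD).mono le_rfl le_rfl le
  | succ i ih =>
    rw [Finset.sum_range_succ, add_mul]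
    refine (ih (by omega)).trans (Adds.biUnion _ _ fun v _ => ?_)
    rw [AlgCircuit.value]
    split
    · exact (Adds.truncCoeffs_lineRestrict_leaf a _ hD).mono le_rfl le_rfl le
    · rename_i T _
      have hT : T.1.card + 1 ≤ A.size + 1 := Nat.succ_le_succ
        ((Finset.card_le_univ _).trans (A.card_layer_le_size (by omega)))
      have hmem : ∀ u ∈ T.1, truncCoeffs D (lineRestrict a (A.value i u)) ⊆
          ∅ ∪ ⋃ v ∈ (Finset.univ : Finset (A.Layer i)),
            truncCoeffs D (lineRestrict a (A.value i v)) := fun u _ =>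
        (Set.subset_biUnion_of_mem (u := fun v => truncCoeffs D (lineRestrict a (A.value i v)))
          (Finset.mem_univ u)).trans Set.subset_union_right
      split_ifs
      · rw [map_sum]
        exact (Adds.truncCoeffs_sum _ _ hmem).mono le_rfl le_rfl (Nat.mul_le_mul_right _ hT)
      · rw [map_prod]
        exact (Adds.truncCoeffs_prod _ _ hmem).mono le_rfl le_rfl (Nat.mul_le_mul_right _ hT)

theorem AlgCircuit.adds_output (A : AlgCircuit F n) (a : Fin n → F) {D : ℕ} (hD : 1 ≤ D)
    {f : MvPolynomial (Fin n) F} (hf : A.Computes f) :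
    Adds ∅ (truncCoeffs D (lineRestrict a f))
      (A.size * ((A.size + 1) * (D * (2 * D + 1)))) := by
  refine (A.adds_layer a hD A.depth le_rfl).mono le_rfl ?_ le_rfl
  rw [← hf]
  exact Set.subset_biUnion_of_mem
    (u := fun v => truncCoeffs D (lineRestrict a (A.value A.depth v))) (Finset.mem_univ A.output)

end Circuit

/-! ### Extracting the e-th root. -/

section Root

/-- The recurrence for the coefficients of an `e`-th root. -/
theorem Polynomial.coeff_pow_recurrence {R : Type*} [CommRing R] (G : Polynomial R) {e : ℕ}
    (he : 1 ≤ e) (t : ℕ) :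
    (e : R) * t * (G ^ e).coeff 0 * G.coeff t =
      ∑ j ∈ Finset.range t, ((t : R) - j - e * j) * (G ^ e).coeff (t - j) * G.coeff j := by
  -- The logarithmic derivative of G^e with denominators cleared; the factor X makes the k-th
  -- coefficient of X·Q' equal to k times that of Q, with no index shift.
  have h : G * (Polynomial.X * derivative (G ^ e)) =
      Polynomial.C (e : R) * ((Polynomial.X * derivative G) * G ^ e) := by
    obtain ⟨e, rfl⟩ : ∃ k, e = k + 1 := ⟨e - 1, by omega⟩
    rw [derivative_pow]
    simp only [add_tsub_cancel_right]
    ring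
  have hX : ∀ (Q : Polynomial R) (k : ℕ), (Polynomial.X * derivative Q).coeff k =
      (k : R) * Q.coeff k := by
    rintro Q (_ | k)
    · simp
    · rw [Polynomial.coeff_X_mul, coeff_derivative]; push_cast; ring
  have h' := congrArg (fun Q => Q.coeff t) h
  simp only [Polynomial.coeff_C_mul] at h'
  rw [Polynomial.coeff_mul, Polynomial.coeff_mul] at h'
  simp only [hX] at h'
  -- The last term, of index t, is split off: on the left it vanishes, on the right it is the one
  -- containing `G.coeff t`.
  rw [Finset.Nat.sum_antidiagonal_eq_sum_range_succ
      (fun i j => G.coeff i * ((j : R) * (G ^ e).coeff j)),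
    Finset.Nat.sum_antidiagonal_eq_sum_range_succ
      (fun i j => (i : R) * G.coeff i * (G ^ e).coeff j),
    Finset.sum_range_succ, Finset.sum_range_succ] at h'
  simp only [tsub_self, Nat.cast_zero, zero_mul, mul_zero, add_zero] at h'
  rw [mul_add, Finset.mul_sum, ← sub_eq_iff_eq_add', ← Finset.sum_sub_distrib] at h'
  rw [mul_assoc, mul_assoc, mul_comm ((G ^ e).coeff 0), ← mul_assoc (t : R), ← h']
  refine Finset.sum_congr rfl fun j hj => ?_
  rw [Nat.cast_sub (Finset.mem_range.1 hj).le]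
  ring

variable {F : Type*} [Field F] [CharZero F] {n : ℕ}

theorem adds_root (g : MvPolynomial (Fin n) F) {e : ℕ} (he : 1 ≤ e) (a : Fin n → F)
    (ha : eval a g ≠ 0) {S : Set (MvPolynomial (Fin n) F)} {D : ℕ}
    (hS : truncCoeffs D (lineRestrict a (g ^ e)) ⊆ S) :
    Adds S (truncCoeffs D (lineRestrict a g)) (D * (4 * D + 1)) := by
  set G := lineRestrict a g with hG
  rw [map_pow, ← hG] at hS
  refine Adds.truncCoeffs_of_prefix fun t ht => ?_
  rcases Nat.eq_zero_or_pos t with rfl | ht0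
  · rw [hG, coeff_zero_lineRestrict]
    exact (Adds.C _).mono le_rfl le_rfl (by omega)
  have hF : (G ^ e).coeff 0 = C (eval a g ^ e) := by
    rw [hG, ← map_pow, coeff_zero_lineRestrict, map_pow]
  obtain ⟨c, hc⟩ : ∃ c : F, c = e * t * eval a g ^ e := ⟨_, rfl⟩
  have hc0 : c ≠ 0 := by
    rw [hc]
    exact mul_ne_zero (mul_ne_zero (Nat.cast_ne_zero.2 (by omega))
      (Nat.cast_ne_zero.2 (by omega))) (pow_ne_zero _ ha)
  have key : G.coeff t = ∑ j ∈ Finset.range t,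
      C (c⁻¹ * ((t : F) - j - e * j)) * (G ^ e).coeff (t - j) * G.coeff j := by
    have h := G.coeff_pow_recurrence he t
    rw [hF] at h
    have h1 : (C c⁻¹ : MvPolynomial (Fin n) F) * C c = 1 := by
      rw [← C_mul, inv_mul_cancel₀ hc0, C_1]
    have h2 : (C c : MvPolynomial (Fin n) F) =
        (e : MvPolynomial (Fin n) F) * (t : MvPolynomial (Fin n) F) * C (eval a g ^ e) := by
      rw [hc]; simp
    rw [← h2] at h
    rw [← one_mul (G.coeff t), ← h1, mul_assoc, h, Finset.mul_sum]
    refine Finset.sum_congr rfl fun j _ => ?_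
    simp only [C_mul, C_sub, map_natCast]
    ring
  rw [key]
  -- Each term costs 3: one constant and two multiplications.
  refine (Adds.sum (c := 3) _ _ fun j hj => ?_).mono le_rfl le_rfl
    (by rw [Finset.card_range]; omega)
  have hj := Finset.mem_range.1 hj
  exact ((Adds.C _).mul (Adds.of_mem (.inl (hS (coeff_mem_truncCoeffs _ (by omega)))))).mul
    (Adds.of_mem (.inr (coeff_mem_truncCoeffs _ hj)))

/-- A field of characteristic zero is infinite, so a polynomial vanishing at all points is zero. -/
theorem exists_eval_ne_zero {g : MvPolynomial (Fin n) F} (hg : g ≠ 0) :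
    ∃ a : Fin n → F, eval a g ≠ 0 := by
  by_contra! h
  exact hg (MvPolynomial.funext fun a => by simpa using h a)

/-- The length of a straight-line program for a root of degree `d` of a polynomial of
size `s`. -/
def rootLength (s d : ℕ) : ℕ :=
  s * ((s + 1) * ((d + 1) * (2 * (d + 1) + 1))) + (d + 1) * (4 * (d + 1) + 1) + ((d + 1) + 1)

theorem straightLineComputes_root (g : MvPolynomial (Fin n) F) {e : ℕ} (he : 1 ≤ e) :
    StraightLineComputes {g} (rootLength (circuitSize (g ^ e)) g.totalDegree) := by
  suffices h : Adds ∅ {g} (rootLength (circuitSize (g ^ e)) g.totalDegree) from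
    (h ∅ le_rfl 0 straightLineComputes_empty).mono Set.subset_union_right (by omega)
  rcases eq_or_ne g 0 with rfl | hg
  · exact Adds.zero.mono le_rfl le_rfl (by unfold rootLength; omega)
  obtain ⟨a, ha⟩ := exists_eval_ne_zero hg
  obtain ⟨A, hA, hs⟩ := exists_computes_size_eq_circuitSize (g ^ e)
  have h1 := A.adds_output a (D := g.totalDegree + 1) (by omega) hA
  have h2 := h1.trans (adds_root g he a ha Set.subset_union_right)
  rw [hs] at h2
  refine h2.trans ?_
  have h3 : g = ∑ k ∈ Finset.range (g.totalDegree + 1), (lineRestrict a g).coeff k := by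
    conv_lhs => rw [← eval_one_lineRestrict a g]
    rw [Polynomial.eval_eq_sum_range' (Nat.lt_succ_of_le (natDegree_lineRestrict_le a g))]
    simp
  have h4 := Adds.sum (S := ∅ ∪ truncCoeffs (g.totalDegree + 1) (lineRestrict a g)) (c := 0)
    (Finset.range (g.totalDegree + 1)) (fun k => (lineRestrict a g).coeff k) fun k hk =>
      Adds.of_mem (.inr (coeff_mem_truncCoeffs _ (Finset.mem_range.1 hk)))
  rw [← h3] at h4
  simpa using h4

end Root

/-! ### From straight-line programs back to alternating layers. -/

section Layering

variable {F : Type*} [CommSemiring F] {n m : ℕ}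

theorem AlgCircuit.value_succ_of_leaf (A : AlgCircuit F n) {i : ℕ} {u : A.Layer (i + 1)}
    {l : LeafLabel F n} (h : A.node i u = .inl l) : A.value (i + 1) u = l.poly := by
  rw [AlgCircuit.value, h]

theorem AlgCircuit.value_succ_of_gate (A : AlgCircuit F n) {i : ℕ} {u : A.Layer (i + 1)}
    {T : {T : Finset (A.Layer i) // T.Nonempty}} (h : A.node i u = .inr T) :
    A.value (i + 1) u = if A.isSum (i + 1) = true then ∑ w ∈ T.1, A.value i w
      else ∏ w ∈ T.1, A.value i w := by
  rw [AlgCircuit.value, h]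

/-- The operation of a `+` gate or of a `×` gate on two polynomials. -/
noncomputable def gateOp (s : Bool) (p q : MvPolynomial (Fin n) F) : MvPolynomial (Fin n) F :=
  if s = true then p + q else p * q

open Classical in
/-- The layered circuit of a straight-line program: every layer has two copies of every step, and
a step that is not an operation of the kind of the layer is copied from the layer below. -/
noncomputable def straightLineCircuit (v : ℕ → MvPolynomial (Fin n) F) (o : Fin m) :
    AlgCircuit F n where
  depth := 2 * m
  Layer _ := Fin m × Bool
  isSum i := decide (Even i)
  isSum_succ i := by by_cases h : Even i <;> simp [h, Nat.even_add_one]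
  -- A dummy value: correctness is only claimed from layer 2 on.
  bottom _ := .inr 0
  node i u :=
    if h : ∃ l : LeafLabel F n, v u.1 = l.poly then .inl h.choose
    else if h : ∃ k : Fin m × Fin m, k.1 < u.1 ∧ k.2 < u.1 ∧
        v u.1 = gateOp (decide (Even (i + 1))) (v k.1) (v k.2) then
      -- Children form a set, so p + p and p * p need two distinct vertices of equal value; the
      -- Boolean tag provides them.
      .inr ⟨{(h.choose.1, false), (h.choose.2, true)}, by simp⟩
    else .inr ⟨{u}, by simp⟩
  output := (o, false)

theorem straightLineCircuit_value_succ (v : ℕ → MvPolynomial (Fin n) F) (o : Fin m) (i : ℕ)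
    (u : Fin m × Bool)
    (ih : ∀ w : Fin m × Bool, w.1 < u.1 → (straightLineCircuit v o).value i w = v w.1)
    (hu : (∃ l : LeafLabel F n, v u.1 = l.poly) ∨
      (∃ k : Fin m × Fin m, k.1 < u.1 ∧ k.2 < u.1 ∧
        v u.1 = gateOp (decide (Even (i + 1))) (v k.1) (v k.2)) ∨
      (straightLineCircuit v o).value i u = v u.1) :
    (straightLineCircuit v o).value (i + 1) u = v u.1 := by
  classical
  let W : Fin m × Bool → MvPolynomial (Fin n) F := (straightLineCircuit v o).value i
  change ∀ w : Fin m × Bool, w.1 < u.1 → W w = v w.1 at ih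
  by_cases h : ∃ l : LeafLabel F n, v u.1 = l.poly
  · have e := (straightLineCircuit v o).value_succ_of_leaf (i := i) (u := u)
      (dif_pos h)
    exact e.trans h.choose_spec.symm
  by_cases h' : ∃ k : Fin m × Fin m, k.1 < u.1 ∧ k.2 < u.1 ∧
      v u.1 = gateOp (decide (Even (i + 1))) (v k.1) (v k.2)
  · obtain ⟨h1, h2, h3⟩ := h'.choose_spec
    have hne : ((h'.choose.1, false) : Fin m × Bool) ≠ (h'.choose.2, true) := by simp
    have e := (straightLineCircuit v o).value_succ_of_gate (i := i) (u := u)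
      ((dif_neg h).trans (dif_pos h'))
    change _ = if decide (Even (i + 1)) = true
      then ∑ w ∈ ({(h'.choose.1, false), (h'.choose.2, true)} : Finset (Fin m × Bool)), W w
      else ∏ w ∈ ({(h'.choose.1, false), (h'.choose.2, true)} : Finset (Fin m × Bool)), W w at e
    rw [Finset.sum_pair hne, Finset.prod_pair hne, ih _ h1, ih _ h2] at e
    exact e.trans h3.symm
  · have e := (straightLineCircuit v o).value_succ_of_gate (i := i) (u := u)
      ((dif_neg h).trans (dif_neg h'))
    change _ = if decide (Even (i + 1)) = true
      then ∑ w ∈ ({u} : Finset (Fin m × Bool)), W w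
      else ∏ w ∈ ({u} : Finset (Fin m × Bool)), W w at e
    rw [Finset.sum_singleton, Finset.prod_singleton, ite_self] at e
    exact e.trans ((hu.resolve_left h).resolve_left h')

/-- Among two consecutive layers one has the kind that a given operation needs, so each step of the
program is delayed by at most two layers. -/
theorem straightLineCircuit_value (v : ℕ → MvPolynomial (Fin n) F) (hv : IsStraightLine v m)
    (o : Fin m) (i : ℕ) (u : Fin m × Bool) (hi : 2 * (u.1.1 + 1) ≤ i) :
    (straightLineCircuit v o).value i u = v u.1 := by
  induction i using Nat.strong_induction_on generalizing u with
  | _ i ih =>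
    obtain ⟨i, rfl⟩ : ∃ k, i = k + 2 := ⟨i - 2, by omega⟩
    have below : ∀ w : Fin m × Bool, w.1 < u.1 → (straightLineCircuit v o).value i w = v w.1 :=
      fun w hw => ih i (by omega) w (by have : w.1.1 < u.1.1 := hw; omega)
    have below' : ∀ w : Fin m × Bool, w.1 < u.1 →
        (straightLineCircuit v o).value (i + 1) w = v w.1 :=
      fun w hw => ih (i + 1) (by omega) w (by have : w.1.1 < u.1.1 := hw; omega)
    refine straightLineCircuit_value_succ v o (i + 1) u below' ?_
    refine (hv u.1 u.1.2).imp_right ?_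
    rintro ⟨j, hj, k, hk, h⟩
    have hs : ∃ s, v u.1 = gateOp s (v j) (v k) := by
      rcases h with h | h
      exacts [⟨true, by simpa [gateOp] using h⟩, ⟨false, by simpa [gateOp] using h⟩]
    obtain ⟨s, hs⟩ := hs
    have hj' : j < m := hj.trans u.1.2
    have hk' : k < m := hk.trans u.1.2
    -- If the top layer has the wrong kind, the layer below it performs the operation and the top
    -- layer copies the result.
    by_cases hs' : s = decide (Even (i + 1 + 1))
    · exact .inl ⟨(⟨j, hj'⟩, ⟨k, hk'⟩), hj, hk, hs' ▸ hs⟩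
    · have hs'' : s = decide (Even (i + 1)) := by
        have h1 : decide (Even (i + 1 + 1)) = !decide (Even (i + 1)) :=
          (straightLineCircuit v o).isSum_succ (i + 1)
        rw [h1] at hs'
        revert hs'
        cases s <;> cases decide (Even (i + 1)) <;> simp
      exact .inr (straightLineCircuit_value_succ v o i u below
        (.inr (.inl ⟨(⟨j, hj'⟩, ⟨k, hk'⟩), hj, hk, hs'' ▸ hs⟩)))

theorem circuitSize_le_of_straightLineComputes {p : MvPolynomial (Fin n) F}
    (h : StraightLineComputes {p} m) : circuitSize p ≤ (2 * m + 1) * (m * 2) := by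
  obtain ⟨m', hm, v, hv, hp⟩ := h
  obtain ⟨o, ho, rfl⟩ := hp p rfl
  let A := straightLineCircuit v (⟨o, ho⟩ : Fin m')
  have hA : A.Computes (v o) :=
    straightLineCircuit_value v hv ⟨o, ho⟩ (2 * m') (⟨o, ho⟩, false)
      (by change 2 * (o + 1) ≤ 2 * m'; omega)
  have hs : A.size = (2 * m' + 1) * (m' * 2) := by
    change ∑ i ∈ Finset.range (2 * m' + 1), Fintype.card (Fin m' × Bool) = _
    simp
  calc circuitSize (v o) ≤ A.size := Nat.sInf_le ⟨A, hA, rfl⟩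
    _ = (2 * m' + 1) * (m' * 2) := hs
    _ ≤ (2 * m + 1) * (m * 2) := by gcongr

end Layering

theorem mainTheorem6 :
    ∃ P : MvPolynomial (Fin 3) ℕ,
      ∀ (F : Type*) [Field F] [CharZero F] (n : ℕ) (f g : MvPolynomial (Fin n) F) (e : ℕ),
        1 ≤ e → f = g ^ e →
          circuitSize g ≤ MvPolynomial.eval ![circuitSize f, g.totalDegree, n] P := by
  let s : MvPolynomial (Fin 3) ℕ := X 0
  let d : MvPolynomial (Fin 3) ℕ := X 1
  let m := s * ((s + 1) * ((d + 1) * (2 * (d + 1) + 1))) + (d + 1) * (4 * (d + 1) + 1) +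
    ((d + 1) + 1)
  refine ⟨(2 * m + 1) * (m * 2), ?_⟩
  rintro F _ _ n _ g e he rfl
  refine (circuitSize_le_of_straightLineComputes (straightLineComputes_root g he)).trans_eq ?_
  simp [m, s, d, rootLength]
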